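/- For $n\ge 1$ let $H(n)=1+\frac12+\cdots+\frac1n$ be the $n$-th harmonic number, and for a prime $p$ let $\nu_p$ denote the $p$-adic valuation on $\mathbb{Q}$. A prime $p\ge 5$ is called a Wolstenholme prime if $p$ divides the numerator of the Bernoulli number $B_{p-3}$. Let $p\geq 5$ be a prime that is not a Wolstenholme prime, and let $n$ be a positive integer with $p\nmid n$ and $\nu_p(H(n))\geq 3$. Below, $m$ and $M$ denote non-negative integers. 1. If $\nu_p(H(n))\geq 4$, then $\nu_p(H(pn))=2$, and from there on the valuations descend by one at each step: $\nu_p(H(p^m\cdot pn))=\nu_p(H(pn))-m=2-m$ for all $m\ge 0$. 2. If $\nu_p(H(n))=3$ and there is no $m$ with $\nu_p(H(p^mn))\leq 2$, then $\nu_p(H(p^mn))=2m+3$ for all $m\ge 0$. 3. If $\nu_p(H(n))=3$ and there is an $m$ with $\nu_p(H(p^mn))\leq 2$, then there is an $M$ such that $\nu_p(H(p^Mn))=0$ and, for all $m\ge 0$, $$\begin{cases}\nu_p(H(p^mn))=2m+3 & \text{if } m<\frac M3-1,\\ \nu_p(H(p^mn))\ge 2m+3 & \text{if } m=\frac M3-1,\\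 \nu_p(H(p^mn))=M-m & \text{if } m>\frac M3-1.\end{cases}$$ -/

import Mathlib

/-- A Wolstenholme prime: a prime `p` dividing (the numerator of) the Bernoulli number `B_{p-3}`.
It is only used for `p ≥ 5`, where the subtraction `p - 3` is not truncated. -/
def IsWolstenholmePrime (p : ℕ) : Prop :=
  p.Prime ∧ (p : ℤ) ∣ (bernoulli (p - 3)).num

/-- The `p`-adic valuation (an integer, possibly negative) of the `n`-th harmonic number
`H(n) = 1 + 1/2 + ⋯ + 1/n`. -/
def nuH (p n : ℕ) : ℤ := padicValRat p (harmonic n)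

/-!
Separating the terms whose denominator is divisible by `p` gives `H(pN) = H(N) / p + S(pN)`, where
`S(L)` is the sum of the `1 / k` with `k < L` and `p ∤ k`. For a prime `p ≥ 5` that is not a
Wolstenholme prime the valuation of `S(L)` is exactly `2 ν_p(L)` when `p ∣ L`: by Euler's theorem
`1 / k` may be replaced by `k ^ (m + 1)` with `m + 2 = φ(p ^ s)` for a large `s`, Faulhaber's
formula makes the sum of these powers congruent to `(m + 1) B_m L ^ 2 / 2` modulo `p L ^ 2`, and
`B_m` is a `p`-adic unit because Kummer's congruence, which comes from Voronoi's, relates it to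
`B_{p-3}`.

Hence for `p ∤ n` the integers `t m = m + ν_p(H(p ^ m n))` are valuations of a sequence in which
the `m`-th step adds a number of valuation `3 m + 3`. A value above this threshold is replaced by
it, a value equal to it by one at least as large, and a value below it never changes again.
-/

section Voronoi

lemma sum_range_mul_mod {M : Type*} [AddCommMonoid M] {a n : ℕ} (h : a.Coprime n) (f : ℕ → M) :
    ∑ k ∈ Finset.range n, f (a * k % n) = ∑ k ∈ Finset.range n, f k := by
  have hmaps : Set.MapsTo (fun k => a * k % n) (Finset.range n) (Finset.range n) := fun k hk =>
    Finset.mem_coe.2 (Finset.mem_range.2 (Nat.mod_lt _ (Nat.zero_lt_of_lt (Finset.mem_range.1 hk))))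
  have hinj : Set.InjOn (fun k => a * k % n) (Finset.range n) := fun i hi j hj hij =>
    (Nat.ModEq.cancel_left_of_coprime h.symm hij).eq_of_lt_of_lt
      (Finset.mem_range.1 hi) (Finset.mem_range.1 hj)
  exact Finset.sum_nbij _ hmaps hinj (Finset.surjOn_of_injOn_of_card_le _ hmaps hinj le_rfl)
    fun _ _ => rfl

lemma sq_dvd_mod_pow_succ_sub (t n m : ℕ) :
    (n : ℤ) ^ 2 ∣ ((t % n : ℕ) : ℤ) ^ (m + 1) -
      ((t : ℤ) ^ (m + 1) - (m + 1) * n * (t / n : ℕ) * (t : ℤ) ^ m) := by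
  have hmod : ((t % n : ℕ) : ℤ) = t + -(n * (t / n : ℕ)) := by
    push_cast
    linear_combination Int.emod_add_mul_ediv t n
  obtain ⟨c, hc⟩ := Polynomial.powAddExpansion (t : ℤ) (-(n * (t / n : ℕ))) (m + 1)
  refine ⟨c * (t / n : ℕ) ^ 2, ?_⟩
  rw [hmod, hc]
  push_cast [Nat.add_sub_cancel]
  ring

theorem voronoi_congruence {a n : ℕ} (h : a.Coprime n) (m : ℕ) :
    (n : ℤ) ^ 2 ∣ ((a : ℤ) ^ (m + 1) - 1) * ∑ k ∈ Finset.range n, (k : ℤ) ^ (m + 1) -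
      (m + 1) * n * a ^ m * ∑ k ∈ Finset.range n, ((a * k / n : ℕ) : ℤ) * (k : ℤ) ^ m := by
  have hterm (k : ℕ) : (m + 1) * n * ((a * k / n : ℕ) : ℤ) * ((a : ℤ) ^ m * (k : ℤ) ^ m) =
      (m + 1) * n * a ^ m * (((a * k / n : ℕ) : ℤ) * (k : ℤ) ^ m) := by
    ring
  have hsum := Finset.dvd_sum (s := Finset.range n) fun k _ => sq_dvd_mod_pow_succ_sub (a * k) n m
  simp only [Finset.sum_sub_distrib, sum_range_mul_mod h fun k => (k : ℤ) ^ (m + 1), hterm,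
    Nat.cast_mul a, mul_pow, ← Finset.mul_sum] at hsum
  rw [← dvd_neg]
  convert hsum using 1
  ring

variable {p : ℕ} [Fact p.Prime]

lemma dvd_pow_sub_pow_of_modEq {k i j : ℕ} (hk : ¬ p ∣ k) (h : i ≡ j [MOD p - 1]) :
    (p : ℤ) ∣ (k : ℤ) ^ i - (k : ℤ) ^ j := by
  have hk' : (k : ZMod p) ≠ 0 := by rwa [Ne, ZMod.natCast_eq_zero_iff]
  rw [← ZMod.intCast_eq_intCast_iff_dvd_sub]
  push_cast
  exact pow_eq_pow_of_modEq h.symm (ZMod.pow_card_sub_one_eq_one hk')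

variable (p) in
lemma exists_not_dvd_and_dvd_pow_sub_one_iff :
    ∃ a : ℕ, ¬ p ∣ a ∧ ∀ m : ℕ, (p : ℤ) ∣ (a : ℤ) ^ m - 1 ↔ p - 1 ∣ m := by
  obtain ⟨g, hg⟩ := IsCyclic.exists_generator (α := (ZMod p)ˣ)
  have hcast : (((g : ZMod p).val : ℕ) : ZMod p) = g := ZMod.natCast_zmod_val _
  refine ⟨(g : ZMod p).val, ?_, fun m => ?_⟩
  · rw [← ZMod.natCast_eq_zero_iff, hcast]
    exact g.ne_zero
  · rw [← ZMod.intCast_zmod_eq_zero_iff_dvd]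
    push_cast
    rw [hcast, sub_eq_zero, ← Units.val_pow_eq_pow_val, Units.val_eq_one,
      ← orderOf_dvd_iff_pow_eq_one, orderOf_eq_card_of_forall_mem_zpowers hg,
      Nat.card_eq_fintype_card, ZMod.card_units]

lemma prime_dvd_sum_range_pow {m : ℕ} (hm : ¬ p - 1 ∣ m + 1) :
    (p : ℤ) ∣ ∑ k ∈ Finset.range p, (k : ℤ) ^ (m + 1) := by
  obtain ⟨a, hpa, ha⟩ := exists_not_dvd_and_dvd_pow_sub_one_iff p
  have hcop : a.Coprime p := ((Nat.Prime.coprime_iff_not_dvd Fact.out).2 hpa).symm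
  have hdvd := (dvd_pow_self (p : ℤ) two_ne_zero).trans (voronoi_congruence hcop m)
  rw [dvd_sub_left (((dvd_mul_left _ _).mul_right _).mul_right _)] at hdvd
  exact ((Nat.prime_iff_prime_int.1 Fact.out).dvd_or_dvd hdvd).resolve_left fun h => hm ((ha _).1 h)

theorem kummer_congruence_sum_range_pow {m m' : ℕ} (h : m ≡ m' [MOD p - 1])
    (hm : ¬ p - 1 ∣ m + 1) :
    (p : ℤ) ^ 2 ∣ (m' + 1) * ∑ k ∈ Finset.range p, (k : ℤ) ^ (m + 1) -
      (m + 1) * ∑ k ∈ Finset.range p, (k : ℤ) ^ (m' + 1) := by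
  obtain ⟨a, hpa, ha⟩ := exists_not_dvd_and_dvd_pow_sub_one_iff p
  have hp : Prime (p : ℤ) := Nat.prime_iff_prime_int.1 Fact.out
  have hcop : a.Coprime p := ((Nat.Prime.coprime_iff_not_dvd Fact.out).2 hpa).symm
  have hm' : ¬ p - 1 ∣ m' + 1 := (h.add_right 1).dvd_iff dvd_rfl |>.not.1 hm
  -- By Fermat the sums on the right of Voronoi's congruences for `m` and `m'` agree modulo `p`.
  have hV : (p : ℤ) ∣ ∑ k ∈ Finset.range p, ((a * k / p : ℕ) : ℤ) * (k : ℤ) ^ m -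
      ∑ k ∈ Finset.range p, ((a * k / p : ℕ) : ℤ) * (k : ℤ) ^ m' := by
    rw [← Finset.sum_sub_distrib]
    refine Finset.dvd_sum fun k hk => ?_
    rw [← mul_sub]
    rcases Nat.eq_zero_or_pos k with rfl | hk0
    · simp
    · exact (dvd_pow_sub_pow_of_modEq
        (Nat.not_dvd_of_pos_of_lt hk0 (Finset.mem_range.1 hk)) h).mul_left _
  obtain ⟨v, hv⟩ := hV
  obtain ⟨x, hx⟩ := dvd_pow_sub_pow_of_modEq hpa h
  obtain ⟨y, hy⟩ := dvd_pow_sub_pow_of_modEq hpa (h.add_right 1)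
  obtain ⟨q, hq⟩ := prime_dvd_sum_range_pow hm'
  obtain ⟨c, hc⟩ := voronoi_congruence hcop m
  obtain ⟨c', hc'⟩ := voronoi_congruence hcop m'
  refine hp.pow_dvd_of_dvd_mul_left 2 (fun hdvd => hm ((ha _).1 hdvd))
    ⟨(m' + 1) * c - (m + 1) * c' + (m + 1) * (m' + 1) * (a ^ m * v + x *
      ∑ k ∈ Finset.range p, ((a * k / p : ℕ) : ℤ) * (k : ℤ) ^ m') - (m + 1) * y * q, ?_⟩
  linear_combination (m' + 1) * hc - (m + 1) * hc' + (m + 1) * (m' + 1) * p * a ^ m * hv +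
    (m + 1) * (m' + 1) * p * (∑ k ∈ Finset.range p, ((a * k / p : ℕ) : ℤ) * (k : ℤ) ^ m') * hx -
    (m + 1) * (∑ k ∈ Finset.range p, (k : ℤ) ^ (m' + 1)) * hy - (m + 1) * p * y * hq

end Voronoi

section Bernoulli

variable {p : ℕ} [Fact p.Prime]

lemma norm_inv_natCast_le {n e : ℕ} (hn : n ≠ 0) (hlt : n < p ^ (e + 1)) :
    ‖((n : ℚ_[p]))⁻¹‖ ≤ (p : ℝ) ^ e := by
  have hlog : padicValNat p n ≤ e :=
    (padicValNat_le_nat_log n).trans (Nat.lt_succ_iff.1 (Nat.log_lt_of_lt_pow hn hlt))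
  rw [norm_inv, Padic.norm_eq_zpow_neg_valuation (Nat.cast_ne_zero.2 hn), Padic.valuation_natCast,
    zpow_neg, inv_inv, zpow_natCast]
  exact pow_le_pow_right₀ (mod_cast (Fact.out : p.Prime).one_le) hlog

lemma norm_natCast_eq_one_of_not_dvd {n : ℕ} (h : ¬ p ∣ n) : ‖(n : ℚ_[p])‖ = 1 :=
  Padic.norm_natCast_eq_one_iff.2 (((Fact.out : p.Prime).coprime_iff_not_dvd).2 h)

lemma norm_inv_prime_le {q : ℕ} (hq : q.Prime) : ‖((q : ℚ_[p]))⁻¹‖ ≤ p := by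
  by_cases h : p ∣ q
  · obtain rfl := (Nat.prime_dvd_prime_iff_eq Fact.out hq).1 h
    rw [norm_inv, Padic.norm_p, inv_inv]
  · rw [norm_inv, norm_natCast_eq_one_of_not_dvd h, inv_one]
    exact_mod_cast (Fact.out : p.Prime).one_le

lemma norm_bernoulli_two_mul_le {k : ℕ} {C : ℝ} (h1 : 1 ≤ C)
    (hC : ∀ q : ℕ, q.Prime → q - 1 ∣ 2 * k → ‖((q : ℚ_[p]))⁻¹‖ ≤ C) :
    ‖((bernoulli (2 * k) : ℚ) : ℚ_[p])‖ ≤ C := by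
  obtain ⟨z, hz⟩ := Bernoulli.vonStaudt_clausen k
  have hB := congrArg (Rat.cast : ℚ → ℚ_[p]) (eq_sub_of_add_eq hz.symm)
  push_cast at hB
  rw [hB, sub_eq_add_neg]
  refine (IsUltrametricDist.norm_add_le_max _ _).trans
    (max_le ((Padic.norm_int_le_one z).trans h1) ?_)
  rw [norm_neg]
  refine IsUltrametricDist.norm_sum_le_of_forall_le_of_nonneg (zero_le_one.trans h1) fun q hq => ?_
  rw [one_div]
  exact hC q (Finset.mem_filter.1 hq).2.1 (Finset.mem_filter.1 hq).2.2

lemma norm_bernoulli_le (n : ℕ) : ‖((bernoulli n : ℚ) : ℚ_[p])‖ ≤ p := by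
  have hp1 : (1 : ℝ) ≤ p := mod_cast (Fact.out : p.Prime).one_le
  rcases n.even_or_odd' with ⟨k, rfl | rfl⟩
  · exact norm_bernoulli_two_mul_le hp1 fun q hq _ => norm_inv_prime_le hq
  · rcases Nat.eq_zero_or_pos k with rfl | hk
    · simpa using norm_inv_prime_le (p := p) Nat.prime_two
    · rw [bernoulli_eq_zero_of_odd (odd_two_mul_add_one k) (by lia), Rat.cast_zero, norm_zero]
      positivity

lemma norm_bernoulli_le_one {n : ℕ} (hn : ¬ p - 1 ∣ n) :
    ‖((bernoulli n : ℚ) : ℚ_[p])‖ ≤ 1 := by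
  have hunit {q : ℕ} (hq : q.Prime) (hqp : p ≠ q) : ‖((q : ℚ_[p]))⁻¹‖ ≤ 1 := by
    rw [norm_inv, norm_natCast_eq_one_of_not_dvd
      fun h => hqp ((Nat.prime_dvd_prime_iff_eq Fact.out hq).1 h), inv_one]
  rcases n.even_or_odd' with ⟨k, rfl | rfl⟩
  · exact norm_bernoulli_two_mul_le le_rfl fun q hq hqk => hunit hq (by rintro rfl; exact hn hqk)
  · rcases Nat.eq_zero_or_pos k with rfl | hk
    · simpa using hunit Nat.prime_two (by rintro rfl; simp at hn)
    · rw [bernoulli_eq_zero_of_odd (odd_two_mul_add_one k) (by lia), Rat.cast_zero, norm_zero]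
      exact zero_le_one

end Bernoulli

section Faulhaber

/-- The `i`-th term of Faulhaber's formula for `∑ k < n, k ^ m`, ordered by increasing powers of
`n`, the exponent being `i + 1`. -/
def faulhaberTerm (m n i : ℕ) : ℚ :=
  m.choose i * bernoulli (m - i) * (n : ℚ) ^ (i + 1) / (i + 1 : ℕ)

lemma sum_range_pow_eq_sum_faulhaberTerm (m n : ℕ) :
    ∑ k ∈ Finset.range n, (k : ℚ) ^ m = ∑ i ∈ Finset.range (m + 1), faulhaberTerm m n i := by
  rw [sum_range_pow, ← Finset.sum_range_reflect]
  refine Finset.sum_congr rfl fun i hi => ?_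
  have him : i ≤ m := Nat.lt_succ_iff.1 (Finset.mem_range.1 hi)
  have hchoose : ((m + 1).choose (m - i) : ℚ) * (i + 1) = (m + 1) * m.choose i := by
    rw [Nat.choose_symm_of_eq_add (by lia : m + 1 = (m - i) + (i + 1))]
    exact_mod_cast (Nat.add_one_mul_choose_eq m i).symm
  rw [faulhaberTerm, show m + 1 - 1 - i = m - i by lia, show m + 1 - (m - i) = i + 1 by lia,
    div_eq_div_iff (by positivity) (by positivity)]
  push_cast
  linear_combination bernoulli (m - i) * (n : ℚ) ^ (i + 1) * hchoose

variable {p : ℕ} [Fact p.Prime]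

lemma norm_natCast_le_inv {n : ℕ} (h : p ∣ n) : ‖(n : ℚ_[p])‖ ≤ (p : ℝ)⁻¹ := by
  simpa using (Padic.norm_int_le_pow_iff_dvd (p := p) n 1).2 (by simpa using mod_cast h)

lemma norm_bernoulli_mul_norm_inv_natCast_le {m c d : ℕ} (hp : c + 3 < p) (hmc : Even (m + c))
    (hdm : c + d + 1 ≤ m) :
    ‖((bernoulli (m - (c + d + 1)) : ℚ) : ℚ_[p])‖ * ‖((c + d + 1 + 1 : ℕ) : ℚ_[p])⁻¹‖ ≤
      (p : ℝ) ^ d := by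
  -- For `d = 0` parity excludes a denominator `p` in the Bernoulli number; for `d > 0` the
  -- factor `p ^ d` absorbs both denominators.
  rcases d with _ | e
  · have hodd : Odd (m - (c + 0 + 1)) := by grind
    have heven : Even (p - 1) :=
      (Fact.out : p.Prime).even_sub_one (by lia)
    refine mul_le_one₀ (norm_bernoulli_le_one fun h => ?_) (norm_nonneg _) ?_
    · exact Nat.not_even_iff_odd.2 hodd (heven.trans_dvd h)
    · simpa using norm_inv_natCast_le (p := p) (n := c + 0 + 1 + 1) (e := 0) (by lia) (by lia)
  · rw [pow_succ']
    refine mul_le_mul (norm_bernoulli_le _) (norm_inv_natCast_le (by lia) ?_) (norm_nonneg _)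
      (Nat.cast_nonneg p)
    calc c + (e + 1) + 1 + 1 < (e + 1) * p := by nlinarith
      _ ≤ p ^ e * p := Nat.mul_le_mul_right _ (Nat.lt_pow_self (Fact.out : p.Prime).one_lt)
      _ = p ^ (e + 1) := (pow_succ _ _).symm

lemma norm_faulhaberTerm_le {m n c i : ℕ} (hp : c + 3 < p) (hn : p ∣ n) (hmc : Even (m + c))
    (hci : c < i) (him : i ≤ m) :
    ‖(faulhaberTerm m n i : ℚ_[p])‖ ≤ ‖(n : ℚ_[p])‖ ^ (c + 1) * (p : ℝ)⁻¹ := by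
  have hp0 : (0 : ℝ) < p := mod_cast (Fact.out : p.Prime).pos
  obtain ⟨d, rfl⟩ := Nat.exists_eq_add_of_lt hci
  have hprod := norm_bernoulli_mul_norm_inv_natCast_le hp hmc him
  have hchoose : ‖(m.choose (c + d + 1) : ℚ_[p])‖ ≤ 1 := by
    simpa using Padic.norm_int_le_one (p := p) (m.choose (c + d + 1))
  have hpow : ‖(n : ℚ_[p])‖ ^ (d + 1) ≤ ((p : ℝ)⁻¹) ^ (d + 1) :=
    pow_le_pow_left₀ (norm_nonneg _) (norm_natCast_le_inv hn) _
  calc ‖(faulhaberTerm m n (c + d + 1) : ℚ_[p])‖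
      = ‖(m.choose (c + d + 1) : ℚ_[p])‖ * (‖((bernoulli (m - (c + d + 1)) : ℚ) : ℚ_[p])‖ *
          ‖((c + d + 1 + 1 : ℕ) : ℚ_[p])⁻¹‖) *
          (‖(n : ℚ_[p])‖ ^ (c + 1) * ‖(n : ℚ_[p])‖ ^ (d + 1)) := by
        rw [faulhaberTerm, Rat.cast_div, Rat.cast_mul, Rat.cast_mul, Rat.cast_pow,
          Rat.cast_natCast, Rat.cast_natCast, Rat.cast_natCast, norm_div, norm_mul, norm_mul,
          norm_pow, norm_inv]
        ring
    _ ≤ 1 * (p : ℝ) ^ d * (‖(n : ℚ_[p])‖ ^ (c + 1) * ((p : ℝ)⁻¹) ^ (d + 1)) := by gcongr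
    _ = ‖(n : ℚ_[p])‖ ^ (c + 1) * (p : ℝ)⁻¹ := by
        rw [inv_pow]
        field_simp
        ring

end Faulhaber

section BernoulliCongruences

variable {p : ℕ} [Fact p.Prime]

lemma norm_sum_range_pow_sub_le {m n c : ℕ} (hp : c + 3 < p) (hn : p ∣ n) (hmc : Even (m + c))
    (hcm : c ≤ m) :
    ‖((∑ k ∈ Finset.range n, (k : ℚ) ^ m -
      ∑ i ∈ Finset.range (c + 1), faulhaberTerm m n i : ℚ) : ℚ_[p])‖ ≤
      ‖(n : ℚ_[p])‖ ^ (c + 1) * (p : ℝ)⁻¹ := by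
  rw [sum_range_pow_eq_sum_faulhaberTerm, ← Finset.sum_Ico_eq_sub _ (by lia), Rat.cast_sum]
  refine IsUltrametricDist.norm_sum_le_of_forall_le_of_nonneg (by positivity) fun i hi => ?_
  obtain ⟨hci, him⟩ := Finset.mem_Ico.1 hi
  exact norm_faulhaberTerm_le hp hn hmc hci (Nat.lt_succ_iff.1 him)

lemma norm_sum_range_pow_sub_mul_bernoulli_le {m n : ℕ} (hp : 3 < p) (hn : p ∣ n) (hm : Even m) :
    ‖((∑ k ∈ Finset.range n, (k : ℚ) ^ m - n * bernoulli m : ℚ) : ℚ_[p])‖ ≤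
      ‖(n : ℚ_[p])‖ * (p : ℝ)⁻¹ := by
  simpa [faulhaberTerm, mul_comm] using
    norm_sum_range_pow_sub_le (c := 0) (by simpa using hp) hn (by simpa using hm) m.zero_le

lemma norm_sum_range_pow_succ_sub_sq_mul_bernoulli_le {m n : ℕ} (hp : 4 < p) (hn : p ∣ n)
    (hm : Even m) (hm0 : m ≠ 0) :
    ‖((∑ k ∈ Finset.range n, (k : ℚ) ^ (m + 1) - (m + 1) * bernoulli m * n ^ 2 / 2 : ℚ) :
      ℚ_[p])‖ ≤ ‖(n : ℚ_[p])‖ ^ 2 * (p : ℝ)⁻¹ := by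
  have hodd : bernoulli (m + 1) = 0 := bernoulli_eq_zero_of_odd hm.add_one (by lia)
  have hsum : ∑ i ∈ Finset.range (1 + 1), faulhaberTerm (m + 1) n i =
      (m + 1) * bernoulli m * n ^ 2 / 2 := by
    rw [Finset.sum_range_succ, Finset.sum_range_one]
    simp [faulhaberTerm, hodd, one_add_one_eq_two]
  rw [← hsum]
  exact norm_sum_range_pow_sub_le hp hn hm.add_one.add_one (by lia)

lemma norm_intCast_mul_le (z : ℤ) (y : ℚ) : ‖((z * y : ℚ) : ℚ_[p])‖ ≤ ‖(y : ℚ_[p])‖ := by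
  rw [Rat.cast_mul, Rat.cast_intCast, norm_mul]
  exact mul_le_of_le_one_left (norm_nonneg _) (Padic.norm_int_le_one z)

lemma three_lt_of_not_sub_one_dvd {m : ℕ} (hm : Even m) (hpm : ¬ p - 1 ∣ m) : 3 < p := by
  by_contra! hle
  have := (Fact.out : p.Prime).two_le
  interval_cases p
  · exact hpm (one_dvd m)
  · exact hpm hm.two_dvd

theorem kummer_congruence_bernoulli {m m' : ℕ} (hm : Even m) (hpm : ¬ p - 1 ∣ m)
    (h : m ≡ m' [MOD p - 1]) :
    ‖((m' * bernoulli m - m * bernoulli m' : ℚ) : ℚ_[p])‖ < 1 := by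
  have hp1 : (1 : ℝ) < p := mod_cast (Fact.out : p.Prime).one_lt
  have hp3 := three_lt_of_not_sub_one_dvd hm hpm
  have hp2 : 2 ∣ p - 1 := ((Fact.out : p.Prime).even_sub_one (by lia)).two_dvd
  have hm' : Even m' := even_iff_two_dvd.2 ((h.dvd_iff hp2).1 hm.two_dvd)
  have hpm' : ¬ p - 1 ∣ m' := (h.dvd_iff dvd_rfl).not.1 hpm
  obtain ⟨a, rfl⟩ := Nat.exists_eq_add_one_of_ne_zero (by rintro rfl; simp at hpm : m ≠ 0)
  obtain ⟨b, rfl⟩ := Nat.exists_eq_add_one_of_ne_zero (by rintro rfl; simp at hpm' : m' ≠ 0)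
  have ha := norm_sum_range_pow_sub_mul_bernoulli_le (n := p) hp3 dvd_rfl hm
  have hb := norm_sum_range_pow_sub_mul_bernoulli_le (n := p) hp3 dvd_rfl hm'
  obtain ⟨c, hc⟩ := kummer_congruence_sum_range_pow (p := p) (h.add_right_cancel' 1) hpm
  replace hc := congrArg (Int.cast : ℤ → ℚ) hc
  push_cast at hc
  rw [Padic.norm_p] at ha hb
  set P : ℚ := ∑ k ∈ Finset.range p, (k : ℚ) ^ (a + 1)
  set Q : ℚ := ∑ k ∈ Finset.range p, (k : ℚ) ^ (b + 1)
  set x : ℚ := (b + 1 : ℕ) * bernoulli (a + 1) - (a + 1 : ℕ) * bernoulli (b + 1) with hx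
  have hpx : p * x = c * (p : ℚ) ^ 2 + (-(b + 1) : ℤ) * (P - p * bernoulli (a + 1)) +
      (a + 1 : ℤ) * (Q - p * bernoulli (b + 1)) := by
    push_cast [hx]
    linear_combination hc
  have hle : ‖((p * x : ℚ) : ℚ_[p])‖ ≤ (p : ℝ)⁻¹ * (p : ℝ)⁻¹ := by
    rw [hpx, Rat.cast_add, Rat.cast_add]
    refine (IsUltrametricDist.norm_add_le_max _ _).trans (max_le
      ((IsUltrametricDist.norm_add_le_max _ _).trans (max_le ((norm_intCast_mul_le _ _).trans ?_)
        ((norm_intCast_mul_le _ _).trans ha))) ((norm_intCast_mul_le _ _).trans hb))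
    simp [sq]
  rw [Rat.cast_mul, Rat.cast_natCast, norm_mul, Padic.norm_p] at hle
  exact (le_of_mul_le_mul_left hle (by positivity)).trans_lt (inv_lt_one_of_one_lt₀ hp1)

end BernoulliCongruences

section CoprimeHarmonic

variable {p : ℕ} [Fact p.Prime]

lemma norm_bernoulli_eq_one_of_modEq {m m' : ℕ} (hm : Even m) (hpm : ¬ p - 1 ∣ m)
    (h : m ≡ m' [MOD p - 1]) (hm0 : ¬ p ∣ m) (hm0' : ¬ p ∣ m')
    (hB : ‖((bernoulli m : ℚ) : ℚ_[p])‖ = 1) : ‖((bernoulli m' : ℚ) : ℚ_[p])‖ = 1 := by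
  have hlt := kummer_congruence_bernoulli hm hpm h
  simp only [Rat.cast_sub, Rat.cast_mul, Rat.cast_natCast] at hlt
  have hnorm : ‖(m' : ℚ_[p]) * (bernoulli m : ℚ)‖ = 1 := by
    rw [norm_mul, norm_natCast_eq_one_of_not_dvd hm0', hB, one_mul]
  have heq := Padic.norm_eq_of_norm_sub_lt_left (hlt.trans_eq hnorm.symm)
  rwa [hnorm, norm_mul, norm_natCast_eq_one_of_not_dvd hm0, one_mul, eq_comm] at heq

lemma norm_bernoulli_eq_one_of_not_dvd_num {n : ℕ} (hn : ¬ p - 1 ∣ n)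
    (hB : ¬ (p : ℤ) ∣ (bernoulli n).num) : ‖((bernoulli n : ℚ) : ℚ_[p])‖ = 1 := by
  refine (norm_bernoulli_le_one hn).antisymm ?_
  have hden : ‖((bernoulli n).den : ℚ_[p])‖ ≤ 1 := by
    simpa using Padic.norm_int_le_one (p := p) (bernoulli n).den
  have hnum : ‖((bernoulli n).num : ℚ_[p])‖ = 1 :=
    (Padic.norm_int_le_one _).antisymm (not_lt.1 (mt Padic.norm_intCast_lt_one_iff.1 hB))
  rw [Rat.cast_def, norm_div, hnum]
  exact one_le_one_div (norm_pos_iff.2 (by exact_mod_cast (bernoulli n).den_ne_zero)) hden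

lemma norm_bernoulli_eq_one_of_dvd_add_two {m : ℕ} (hp : 5 ≤ p) (hW : ¬ IsWolstenholmePrime p)
    (hm : p * (p - 1) ∣ m + 2) :
    ‖((bernoulli m : ℚ) : ℚ_[p])‖ = 1 := by
  have heven : Even (p - 3) := by
    have hpred := (Fact.out : p.Prime).even_sub_one (by lia)
    grind
  have hndvd : ¬ p - 1 ∣ p - 3 := Nat.not_dvd_of_pos_of_lt (by lia) (by lia)
  have hmod : p - 3 ≡ m [MOD p - 1] := by
    refine Nat.ModEq.add_right_cancel' 2 ?_
    rw [show p - 3 + 2 = p - 1 by lia]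
    exact (Nat.modEq_zero_iff_dvd.2 dvd_rfl).trans
      (Nat.modEq_zero_iff_dvd.2 (dvd_of_mul_left_dvd hm)).symm
  have hpm : ¬ p ∣ m := fun h => Nat.not_dvd_of_pos_of_lt two_pos (show 2 < p by lia)
    ((Nat.dvd_add_right h).1 (dvd_of_mul_right_dvd hm))
  exact norm_bernoulli_eq_one_of_modEq heven hndvd hmod
    (Nat.not_dvd_of_pos_of_lt (by lia) (by lia)) hpm
      (norm_bernoulli_eq_one_of_not_dvd_num hndvd fun h => hW ⟨Fact.out, h⟩)

/-- The sum of the inverses of the integers `k < n` that are prime to `p`: what remains of a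
harmonic number after removal of the terms with denominator divisible by `p`. The upper bound is
excluded, which makes no difference when `p ∣ n`. -/
def coprimeHarmonic (p n : ℕ) : ℚ := ∑ k ∈ Finset.range n with ¬ p ∣ k, (k : ℚ)⁻¹

lemma harmonic_prime_mul (n : ℕ) :
    harmonic (p * n) = (p : ℚ)⁻¹ * harmonic n + coprimeHarmonic p (p * n) := by
  have hharmonic (j : ℕ) : harmonic j = ∑ k ∈ Finset.range (j + 1), (k : ℚ)⁻¹ := by
    rw [Finset.sum_range_succ']
    simp [harmonic]
  have hcoprime : ∑ k ∈ Finset.range (p * n + 1) with ¬ p ∣ k, (k : ℚ)⁻¹ =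
      coprimeHarmonic p (p * n) := by
    rw [Finset.range_add_one, Finset.filter_insert, if_neg (not_not.2 (dvd_mul_right p n)),
      coprimeHarmonic]
  have hdvd : (p : ℚ)⁻¹ * ∑ k ∈ Finset.range (n + 1), (k : ℚ)⁻¹ =
      ∑ k ∈ Finset.range (p * n + 1) with p ∣ k, (k : ℚ)⁻¹ := by
    have hp0 : 0 < p := (Fact.out : p.Prime).pos
    rw [Finset.mul_sum]
    refine Finset.sum_nbij (p * ·) (fun k hk => ?_)
      (fun _ _ _ _ h => Nat.eq_of_mul_eq_mul_left hp0 h) ?_ fun k _ => by rw [Nat.cast_mul, mul_inv]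
    · simpa [Nat.lt_succ_iff, hp0] using hk
    · rintro _ hk
      obtain ⟨hk, k, rfl⟩ := Finset.mem_filter.1 hk
      exact ⟨k, by simpa [Nat.lt_succ_iff, hp0] using hk, rfl⟩
  rw [hharmonic, hharmonic, hdvd, ← hcoprime, Finset.sum_filter_add_sum_filter_not]

lemma norm_pow_totient_sub_one_le {k N : ℕ} (hk : ¬ p ∣ k) :
    ‖(k : ℚ_[p]) ^ Nat.totient (p ^ N) - 1‖ ≤ (p : ℝ) ^ (-N : ℤ) := by
  have hcop : k.Coprime (p ^ N) :=
    (((Fact.out : p.Prime).coprime_iff_not_dvd).2 hk).symm.pow_right N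
  have hdvd := Nat.modEq_iff_dvd.1 (Nat.ModEq.pow_totient hcop).symm
  generalize Nat.totient (p ^ N) = t at hdvd ⊢
  push_cast at hdvd
  have hle := (Padic.norm_int_le_pow_iff_dvd _ N).2 hdvd
  push_cast at hle
  exact hle

lemma norm_coprimeHarmonic_sub_sum_range_pow_le {e N : ℕ} (he : e + 1 = Nat.totient (p ^ N))
    (hN : N ≤ e) (n : ℕ) :
    ‖((coprimeHarmonic p n - ∑ k ∈ Finset.range n, (k : ℚ) ^ e : ℚ) : ℚ_[p])‖ ≤
      (p : ℝ) ^ (-N : ℤ) := by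
  rw [coprimeHarmonic, Finset.sum_filter, ← Finset.sum_sub_distrib, Rat.cast_sum]
  refine IsUltrametricDist.norm_sum_le_of_forall_le_of_nonneg (by positivity) fun k _ => ?_
  by_cases hk : p ∣ k
  · have hp1 : (p : ℝ)⁻¹ ≤ 1 := inv_le_one_of_one_le₀ (mod_cast (Fact.out : p.Prime).one_le)
    rw [if_neg (not_not.2 hk), zero_sub, Rat.cast_neg, norm_neg, Rat.cast_pow, Rat.cast_natCast,
      norm_pow, zpow_neg, zpow_natCast, ← inv_pow]
    exact (pow_le_pow_left₀ (norm_nonneg _) (norm_natCast_le_inv hk) e).trans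
      (pow_le_pow_of_le_one (by positivity) hp1 hN)
  · have hk1 := norm_natCast_eq_one_of_not_dvd hk
    have hk0 : (k : ℚ_[p]) ≠ 0 := norm_ne_zero_iff.1 (by rw [hk1]; exact one_ne_zero)
    have hfac : (((k : ℚ)⁻¹ - (k : ℚ) ^ e : ℚ) : ℚ_[p]) =
        -((k : ℚ_[p])⁻¹ * ((k : ℚ_[p]) ^ (e + 1) - 1)) := by
      push_cast
      field_simp
      ring
    rw [if_pos hk, hfac, norm_neg, norm_mul, norm_inv, hk1, inv_one, one_mul, he]
    exact norm_pow_totient_sub_one_le hk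

lemma norm_coprimeHarmonic_sub_sq_mul_bernoulli_le {m n : ℕ} (hp : 5 ≤ p) (hn : p ∣ n)
    (hn0 : n ≠ 0) (hm : m + 2 = Nat.totient (p ^ (2 * padicValNat p n + 1))) :
    ‖((coprimeHarmonic p n - (m + 1) * bernoulli m * n ^ 2 / 2 : ℚ) : ℚ_[p])‖ ≤
      ‖(n : ℚ_[p])‖ ^ 2 * (p : ℝ)⁻¹ := by
  set r := padicValNat p n with hr
  have hr0 : r ≠ 0 := Nat.one_le_iff_ne_zero.1 (one_le_padicValNat_of_dvd hn0 hn)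
  have hp0 : (p : ℝ) ≠ 0 := mod_cast (Fact.out : p.Prime).ne_zero
  have hnorm : (p : ℝ) ^ (-(2 * r + 1 : ℕ) : ℤ) = ‖(n : ℚ_[p])‖ ^ 2 * (p : ℝ)⁻¹ := by
    rw [Padic.norm_eq_zpow_neg_valuation (Nat.cast_ne_zero.2 hn0), Padic.valuation_natCast, ← hr]
    rw [← zpow_natCast, ← zpow_mul, ← zpow_sub_one₀ hp0]
    congr 1
    push_cast
    ring
  have hle : 2 * r + 1 ≤ m + 1 := by
    rw [Nat.totient_prime_pow_succ Fact.out] at hm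
    have hlt := Nat.lt_pow_self (n := 2 * r) (Fact.out : p.Prime).one_lt
    have hmul := Nat.mul_le_mul_left (p ^ (2 * r)) (show 2 ≤ p - 1 by lia)
    lia
  have hm2 : Even m := by
    have htot : Even (m + 2) := hm ▸ Nat.totient_even
      ((show 2 < p by lia).trans_le (Nat.le_self_pow (by lia) p))
    simpa [Nat.even_add] using htot
  have hEuler := norm_coprimeHarmonic_sub_sum_range_pow_le hm hle n
  have hFaulhaber :=
    norm_sum_range_pow_succ_sub_sq_mul_bernoulli_le hp hn hm2 (by lia)
  rw [hnorm] at hEuler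
  rw [← sub_add_sub_cancel _ (∑ k ∈ Finset.range n, (k : ℚ) ^ (m + 1)), Rat.cast_add]
  exact (IsUltrametricDist.norm_add_le_max _ _).trans (max_le hEuler hFaulhaber)

theorem norm_coprimeHarmonic (hp : 5 ≤ p) (hW : ¬ IsWolstenholmePrime p) {n : ℕ}
    (hn : p ∣ n) (hn0 : n ≠ 0) :
    ‖((coprimeHarmonic p n : ℚ) : ℚ_[p])‖ = ‖(n : ℚ_[p])‖ ^ 2 := by
  have hpp : p.Prime := Fact.out
  obtain ⟨s, hs⟩ := Nat.exists_eq_add_of_le' (one_le_padicValNat_of_dvd hn0 hn)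
  have htot : Nat.totient (p ^ (2 * padicValNat p n + 1)) = p ^ (2 * s + 1) * (p * (p - 1)) := by
    rw [Nat.totient_prime_pow_succ hpp, hs]
    ring
  have htwo : 2 ≤ p ^ (2 * s + 1) * (p * (p - 1)) :=
    (show 2 ≤ p * (p - 1) by nlinarith [show 1 ≤ p - 1 by lia]).trans
      (Nat.le_mul_of_pos_left _ (pow_pos hpp.pos _))
  obtain ⟨m, hm⟩ := Nat.exists_eq_add_of_le' htwo
  have hdvd : p * (p - 1) ∣ m + 2 := hm ▸ dvd_mul_left _ _
  have hunit : ‖((m + 1 : ℕ) : ℚ_[p])‖ = 1 := norm_natCast_eq_one_of_not_dvd fun h =>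
    hpp.one_lt.ne' (Nat.dvd_one.1 ((Nat.dvd_add_right h).1 (dvd_of_mul_right_dvd hdvd)))
  have htwo_unit : ‖((2 : ℕ) : ℚ_[p])‖ = 1 :=
    norm_natCast_eq_one_of_not_dvd (Nat.not_dvd_of_pos_of_lt two_pos (by lia))
  have hmain : ‖(((m + 1) * bernoulli m * n ^ 2 / 2 : ℚ) : ℚ_[p])‖ = ‖(n : ℚ_[p])‖ ^ 2 := by
    push_cast at hunit htwo_unit ⊢
    rw [norm_div, norm_mul, norm_mul, norm_bernoulli_eq_one_of_dvd_add_two hp hW hdvd, hunit,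
      htwo_unit, norm_pow, one_mul, one_mul, div_one]
  rw [← hmain]
  refine Padic.norm_eq_of_norm_sub_lt_right ?_
  rw [← Rat.cast_sub, hmain]
  exact (norm_coprimeHarmonic_sub_sq_mul_bernoulli_le hp hn hn0 (hm.symm.trans htot.symm)).trans_lt
    (mul_lt_of_lt_one_right (pow_pos (norm_pos_iff.2 (Nat.cast_ne_zero.2 hn0)) 2)
      (inv_lt_one_of_one_lt₀ (mod_cast hpp.one_lt)))

end CoprimeHarmonic

section Valuation

variable {p : ℕ} [Fact p.Prime]

lemma coprimeHarmonic_ne_zero (hp : 5 ≤ p) (hW : ¬ IsWolstenholmePrime p) {n : ℕ}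
    (hn : p ∣ n) (hn0 : n ≠ 0) : coprimeHarmonic p n ≠ 0 := by
  have hnorm := norm_coprimeHarmonic hp hW hn hn0
  intro h
  rw [h, Rat.cast_zero, norm_zero, eq_comm, pow_eq_zero_iff two_ne_zero, norm_eq_zero,
    Nat.cast_eq_zero] at hnorm
  exact hn0 hnorm

lemma padicValRat_coprimeHarmonic (hp : 5 ≤ p) (hW : ¬ IsWolstenholmePrime p) {n : ℕ}
    (hn : p ∣ n) (hn0 : n ≠ 0) : padicValRat p (coprimeHarmonic p n) = 2 * padicValNat p n := by
  have hnorm := norm_coprimeHarmonic hp hW hn hn0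
  rw [Padic.norm_eq_zpow_neg_valuation
      (Rat.cast_ne_zero.2 (coprimeHarmonic_ne_zero hp hW hn hn0)), Padic.valuation_ratCast,
    Padic.norm_eq_zpow_neg_valuation (Nat.cast_ne_zero.2 hn0), Padic.valuation_natCast,
    ← zpow_natCast, ← zpow_mul] at hnorm
  have hexp := zpow_right_injective₀ (mod_cast (Fact.out : p.Prime).pos)
    (mod_cast (Fact.out : p.Prime).one_lt.ne') hnorm
  lia

lemma nuH_prime_mul (hp : 5 ≤ p) (hW : ¬ IsWolstenholmePrime p) {n : ℕ}
    (hn0 : n ≠ 0) :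
    min (nuH p n - 1) (2 * (padicValNat p n + 1)) ≤ nuH p (p * n) ∧
      (nuH p n - 1 ≠ 2 * (padicValNat p n + 1) →
        nuH p (p * n) = min (nuH p n - 1) (2 * (padicValNat p n + 1))) := by
  have hpp : p.Prime := Fact.out
  have hpn0 : p * n ≠ 0 := mul_ne_zero hpp.ne_zero hn0
  have hH : harmonic n ≠ 0 := (harmonic_pos hn0).ne'
  have hp0 : (p : ℚ)⁻¹ ≠ 0 := inv_ne_zero (Nat.cast_ne_zero.2 hpp.ne_zero)
  have hfst : padicValRat p ((p : ℚ)⁻¹ * harmonic n) = nuH p n - 1 := by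
    rw [padicValRat.mul hp0 hH, padicValRat.inv, padicValRat.self hpp.one_lt, nuH, neg_add_eq_sub]
  have hsnd : padicValRat p (coprimeHarmonic p (p * n)) = 2 * (padicValNat p n + 1) := by
    rw [padicValRat_coprimeHarmonic hp hW (dvd_mul_right p n) hpn0,
      padicValNat.mul hpp.ne_zero hn0, padicValNat_self, add_comm, Nat.cast_add, Nat.cast_one]
  have hsum : (p : ℚ)⁻¹ * harmonic n + coprimeHarmonic p (p * n) ≠ 0 :=
    harmonic_prime_mul (p := p) n ▸ (harmonic_pos hpn0).ne'
  rw [← hfst, ← hsnd, nuH, harmonic_prime_mul]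
  exact ⟨padicValRat.min_le_padicValRat_add hsum, padicValRat.add_eq_min hsum (mul_ne_zero hp0 hH)
    (coprimeHarmonic_ne_zero hp hW (dvd_mul_right p n) hpn0)⟩

end Valuation

/-- The constraint on the valuations `t` of a sequence in a non-archimedean field each of whose
terms arises from the previous one by adding an element of valuation `c m`. -/
def UltrametricRecursion (c t : ℕ → ℤ) : Prop :=
  ∀ m, min (t m) (c m) ≤ t (m + 1) ∧ (t m ≠ c m → t (m + 1) = min (t m) (c m))

namespace UltrametricRecursion

variable {c t : ℕ → ℤ}

lemma eq_of_lt (h : UltrametricRecursion c t) (hc : Monotone c) {k m : ℕ} (hk : t k < c k)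
    (hkm : k ≤ m) : t m = t k := by
  induction m, hkm using Nat.le_induction with
  | base => rfl
  | succ m hkm ih =>
    have hm : t m < c m := ih ▸ hk.trans_le (hc hkm)
    rw [(h m).2 hm.ne, min_eq_left hm.le, ih]

lemma succ_eq_of_lt (h : UltrametricRecursion c t) {m : ℕ} (hm : c m < t m) : t (m + 1) = c m := by
  rw [(h m).2 hm.ne', min_eq_right hm.le]

lemma eq_of_le_of_lt_succ (h : UltrametricRecursion c t) {m : ℕ} (hm : c m ≤ t m)
    (hlt : c m < t (m + 1)) : t m = c m := by
  by_contra hne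
  exact hlt.ne' (h.succ_eq_of_lt (hm.lt_of_ne' hne))

lemma exists_limit (h : UltrametricRecursion c t) (hc : StrictMono c) (h0 : c 0 ≤ t 0)
    (hex : ∃ m, t m < c m) :
    ∃ v, c 0 ≤ v ∧ ∀ m, (c m < v → t m = c m) ∧ (c m = v → c m ≤ t m) ∧ (v < c m → t m = v) := by
  classical
  obtain ⟨k, hk⟩ := Nat.exists_eq_add_one_of_ne_zero
    (fun hzero => (Nat.find_spec hex).not_ge (hzero ▸ h0) : Nat.find hex ≠ 0)
  have hlt : t (k + 1) < c (k + 1) := hk ▸ Nat.find_spec hex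
  have hle {m : ℕ} (hm : m ≤ k) : c m ≤ t m := not_lt.1 (Nat.find_min hex (by lia))
  have hck : c k ≤ t (k + 1) := (le_min (hle le_rfl) le_rfl).trans (h k).1
  refine ⟨t (k + 1), (hc.monotone k.zero_le).trans hck, fun m => ⟨fun hm => ?_, fun hm => ?_,
    fun hm => h.eq_of_lt hc.monotone hlt (hc.lt_iff_lt.1 (hck.trans_lt hm))⟩⟩
  · have hmk : m ≤ k := Nat.lt_succ_iff.1 (hc.lt_iff_lt.1 (hm.trans hlt))
    refine h.eq_of_le_of_lt_succ (hle hmk) ?_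
    rcases hmk.eq_or_lt with rfl | hmk
    · exact hm
    · exact (hc (Nat.lt_succ_self m)).trans_le (hle hmk)
  · exact hle (Nat.lt_succ_iff.1 (hc.lt_iff_lt.1 (hm.trans_lt hlt)))

end UltrametricRecursion

section PrimePowerMultiples

variable {p n : ℕ} [Fact p.Prime]

lemma ultrametricRecursion_nuH (hp : 5 ≤ p) (hW : ¬ IsWolstenholmePrime p)
    (hpn : ¬ p ∣ n) :
    UltrametricRecursion (fun m => 3 * m + 3) (fun m => m + nuH p (p ^ m * n)) := by
  intro m
  have hpm0 : p ^ m ≠ 0 := pow_ne_zero m (Fact.out : p.Prime).ne_zero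
  have hn0 : n ≠ 0 := fun h => hpn (h ▸ dvd_zero p)
  have hval : padicValNat p (p ^ m * n) = m := by
    rw [padicValNat.mul hpm0 hn0, padicValNat.prime_pow, padicValNat.eq_zero_of_not_dvd hpn,
      add_zero]
  have hstep := nuH_prime_mul hp hW (mul_ne_zero hpm0 hn0)
  rw [hval, ← mul_assoc, ← pow_succ'] at hstep
  push_cast
  lia

lemma strictMono_three_mul_add_three : StrictMono fun m : ℕ => (3 * m + 3 : ℤ) := by
  intro i j hij
  dsimp only
  lia

lemma nuH_pow_mul_prime_mul (hp : 5 ≤ p) (hW : ¬ IsWolstenholmePrime p)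
    (hpn : ¬ p ∣ n) (hn : 4 ≤ nuH p n) (m : ℕ) : nuH p (p ^ m * (p * n)) = 2 - m := by
  have h := ultrametricRecursion_nuH hp hW hpn
  have hone := h.succ_eq_of_lt (m := 0) (by simpa using Int.lt_of_add_one_le hn)
  have hconst := h.eq_of_lt strictMono_three_mul_add_three.monotone (k := 1) (m := m + 1)
    (by norm_num at hone ⊢; lia) (Nat.le_add_left 1 m)
  rw [hone, pow_succ, mul_assoc] at hconst
  push_cast at hconst
  lia

lemma nuH_pow_mul_of_forall_le (hp : 5 ≤ p) (hW : ¬ IsWolstenholmePrime p)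
    (hpn : ¬ p ∣ n) {b : ℤ} (hb : ∀ m : ℕ, b ≤ nuH p (p ^ m * n)) (m : ℕ) :
    nuH p (p ^ m * n) = 2 * m + 3 := by
  have h := ultrametricRecursion_nuH hp hW hpn
  have hle (k : ℕ) : (3 * k + 3 : ℤ) ≤ k + nuH p (p ^ k * n) := by
    by_contra! hlt
    have hconst := h.eq_of_lt strictMono_three_mul_add_three.monotone hlt
      (Nat.le_add_right k (nuH p (p ^ k * n) + 1 - b).toNat)
    have := hb (k + (nuH p (p ^ k * n) + 1 - b).toNat)
    lia
  have heq := h.eq_of_le_of_lt_succ (hle m) (by have := hle (m + 1); push_cast at this ⊢; lia)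
  lia

lemma exists_nuH_pow_mul_eq (hp : 5 ≤ p) (hW : ¬ IsWolstenholmePrime p)
    (hpn : ¬ p ∣ n) (hn : 3 ≤ nuH p n) (hex : ∃ m : ℕ, nuH p (p ^ m * n) < 2 * m + 3) :
    ∃ M : ℕ, ∀ m : ℕ, (3 * m + 3 < M → nuH p (p ^ m * n) = 2 * m + 3) ∧
      (3 * m + 3 = M → 2 * m + 3 ≤ nuH p (p ^ m * n)) ∧
      (M < 3 * m + 3 → nuH p (p ^ m * n) = M - m) := by
  obtain ⟨k, hk⟩ := hex
  obtain ⟨v, hv, hlim⟩ := (ultrametricRecursion_nuH hp hW hpn).exists_limit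
    strictMono_three_mul_add_three (by simpa using hn) ⟨k, by lia⟩
  lift v to ℕ using by lia
  refine ⟨v, fun m => ?_⟩
  have := hlim m
  lia

end PrimePowerMultiples

theorem mainTheorem1 (p n : ℕ) (hp : p.Prime) (hp5 : 5 ≤ p) (hW : ¬ IsWolstenholmePrime p)
    (hpn : ¬ p ∣ n) (hn : 3 ≤ nuH p n) :
    (4 ≤ nuH p n →
      nuH p (p * n) = 2 ∧ ∀ m : ℕ, nuH p (p ^ m * (p * n)) = nuH p (p * n) - m) ∧
    (nuH p n = 3 → (¬ ∃ m : ℕ, nuH p (p ^ m * n) ≤ 2) →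
      ∀ m : ℕ, nuH p (p ^ m * n) = 2 * m + 3) ∧
    (nuH p n = 3 → (∃ m : ℕ, nuH p (p ^ m * n) ≤ 2) →
      ∃ M : ℕ, nuH p (p ^ M * n) = 0 ∧
        ∀ m : ℕ,
          ((m : ℚ) < M / 3 - 1 → nuH p (p ^ m * n) = 2 * m + 3) ∧
          ((m : ℚ) = M / 3 - 1 → 2 * m + 3 ≤ nuH p (p ^ m * n)) ∧
          ((M : ℚ) / 3 - 1 < m → nuH p (p ^ m * n) = M - m)) := by
  have : Fact p.Prime := ⟨hp⟩
  refine ⟨fun h4 => ?_, fun _ hno => ?_, fun _ hex => ?_⟩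
  · have hdescent := nuH_pow_mul_prime_mul hp5 hW hpn h4
    have h2 : nuH p (p * n) = 2 := by simpa using hdescent 0
    exact ⟨h2, fun m => by rw [h2, hdescent m]⟩
  · push Not at hno
    exact nuH_pow_mul_of_forall_le hp5 hW hpn fun m => (hno m).le
  · obtain ⟨k, hk⟩ := hex
    obtain ⟨M, hM⟩ := exists_nuH_pow_mul_eq hp5 hW hpn hn ⟨k, by lia⟩
    refine ⟨M, by simpa using (hM M).2.2 (by lia), fun m => ⟨fun h => (hM m).1 ?_,
      fun h => (hM m).2.1 ?_, fun h => (hM m).2.2 ?_⟩⟩ <;> qify <;> linarith
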